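/- Let $k$ be a field, $R=k[x_1,\dots,x_n]$ the standard graded polynomial ring, $\mathfrak m=(x_1,\dots,x_n)$, and let $I\subseteq \mathfrak m^2$ be a homogeneous ideal. Let $s\ge 1$ be an integer. Assume that one of the following conditions holds: (i) $\operatorname{char} k=0$; (ii) $I$ is a monomial ideal; (iii) $I^t$ is Koszul for all $1\le t\le s$. Then for every $1\le t\le s$, we have $\mathfrak m^{s-t}I^t\subseteq \mathfrak m^{s-t+1}I^{t-1}$, and the inclusion map $\mathfrak m^{s-t}I^t\to \mathfrak m^{s-t+1}I^{t-1}$ is Tor-vanishing, i.e. the induced map $$\operatorname{Tor}^R_i(k,\mathfrak m^{s-t}I^t)\to \operatorname{Tor}^R_i(k,\mathfrak m^{s-t+1}I^{t-1})$$ is zero for all $i\ge 0$. Here a finitely generated graded $R$-module $M$ is called *Koszul* if its linearity defect is $0$. The linearity defect of $M$ is defined as follows: let $X$ be the minimal graded free resolution of $M$, let $\mathcal F^pX$ be the subcomplex of $X$ with $(\mathcal F^pX)_i=\mathfrak m^{p-i}X_i$ (where $\mathfrak m^{j}=R$ for $j\le 0$), and let $\operatorname{lin}^R X=\bigoplus_{p\ge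 0}\mathcal F^pX/\mathcal F^{p+1}X$; then the linearity defect of $M$ is $\sup\{i : H_i(\operatorname{lin}^R X)\ne 0\}$, taken to be $0$ if $M=0$. -/

import Mathlib

universe u

namespace PolyRing

variable (k : Type u) [Field k] (n : ℕ)

/-- The residue field `k = R/𝔪`, as a module over `R = k[x₁, …, xₙ]`, where
`𝔪 = (x₁, …, xₙ)` is the graded maximal ideal. -/
noncomputable def residueModule : ModuleCat.{u} (MvPolynomial (Fin n) k) :=
  ModuleCat.of (MvPolynomial (Fin n) k) (MvPolynomial (Fin n) k ⧸ MvPolynomial.idealOfVars (Fin n) k)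

variable {k n}

/-- A homogeneous ideal, for the standard grading of `k[x₁, …, xₙ]`. -/
def IsHomogeneousIdeal (I : Ideal (MvPolynomial (Fin n) k)) : Prop :=
  letI := MvPolynomial.gradedAlgebra (σ := Fin n) (R := k)
  I.IsHomogeneous (MvPolynomial.homogeneousSubmodule (Fin n) k)

/-- A monomial ideal: an ideal generated by monomials. -/
def IsMonomialIdeal (I : Ideal (MvPolynomial (Fin n) k)) : Prop :=
  ∃ S : Set (Fin n →₀ ℕ), I = Ideal.span ((fun a => MvPolynomial.monomial a (1 : k)) '' S)

/-- An `R`-linear map `φ` is Tor-vanishing if `Tor_i^R(k, φ) = 0` for all `i`. -/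
def IsTorVanishing {M N : Type u} [AddCommGroup M] [AddCommGroup N]
    [Module (MvPolynomial (Fin n) k) M] [Module (MvPolynomial (Fin n) k) N]
    (φ : M →ₗ[MvPolynomial (Fin n) k] N) : Prop :=
  ∀ i : ℕ, ((CategoryTheory.Tor (ModuleCat.{u} (MvPolynomial (Fin n) k)) i).obj (residueModule k n)).map
    (ModuleCat.ofHom φ) = 0

/-- `v` is homogeneous of degree `j` in the graded free module `⨁_p R(-deg p)`. -/
def IsHomogeneousVec {r : ℕ} (deg : Fin r → ℕ) (v : Fin r → MvPolynomial (Fin n) k) (j : ℕ) :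
    Prop :=
  ∀ p, ∀ a ∈ (v p).support, a.degree + deg p = j

/-- A minimal graded free resolution `⋯ → X₁ → X₀ → J → 0` of an ideal `J`, where
`X_i = ⨁_p R(-deg i p)`. -/
structure MinGradedFreeRes (J : Ideal (MvPolynomial (Fin n) k)) where
  /-- The rank of `X_i`. -/
  rank : ℕ → ℕ
  /-- The degrees of the basis elements of `X_i`. -/
  deg : ∀ i, Fin (rank i) → ℕ
  /-- The differential `X_{i+1} → X_i`. -/
  d : ∀ i, (Fin (rank (i + 1)) → MvPolynomial (Fin n) k) →ₗ[MvPolynomial (Fin n) k]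
    (Fin (rank i) → MvPolynomial (Fin n) k)
  /-- The augmentation `X₀ → J`. -/
  aug : (Fin (rank 0) → MvPolynomial (Fin n) k) →ₗ[MvPolynomial (Fin n) k] J
  d_homogeneous : ∀ i j v, IsHomogeneousVec (deg (i + 1)) v j → IsHomogeneousVec (deg i) (d i v) j
  aug_homogeneous : ∀ j v, IsHomogeneousVec (deg 0) v j →
    (aug v : MvPolynomial (Fin n) k).IsHomogeneous j
  aug_surjective : Function.Surjective aug
  exact_zero : Function.Exact (d 0) aug
  exact_succ : ∀ i, Function.Exact (d (i + 1)) (d i)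
  minimal : ∀ i, LinearMap.range (d i) ≤ MvPolynomial.idealOfVars (Fin n) k • ⊤

namespace MinGradedFreeRes

variable {J : Ideal (MvPolynomial (Fin n) k)} (X : MinGradedFreeRes J)

/-- The degree `i` part `𝔪^{p-i} X_i` of the subcomplex `ℱ^p X` (truncated subtraction: it is
all of `X_i` for `i ≥ p`). -/
noncomputable def filt (p i : ℕ) :
    Submodule (MvPolynomial (Fin n) k) (Fin (X.rank i) → MvPolynomial (Fin n) k) :=
  MvPolynomial.idealOfVars (Fin n) k ^ (p - i) • ⊤

lemma d_mem_filt (p i : ℕ) (v) (hv : v ∈ X.filt p (i + 1)) : X.d i v ∈ X.filt p i := by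
  have h1 : X.d i v ∈ (X.filt p (i + 1)).map (X.d i) := Submodule.mem_map_of_mem hv
  unfold filt at h1 ⊢
  rw [Submodule.map_smul'', Submodule.map_top] at h1
  rcases Nat.lt_or_ge i p with h | h
  · have h2 : p - i = (p - (i + 1)) + 1 := by omega
    rw [h2, pow_succ, Submodule.mul_smul]
    exact Submodule.smul_mono le_rfl (X.minimal i) h1
  · rw [Nat.sub_eq_zero_of_le h, pow_zero, Submodule.one_smul]
    exact Submodule.mem_top

/-- The piece `(ℱ^p X)_i / (ℱ^{p+1} X)_i` of the linear part of `X`. -/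
abbrev LinPiece (i p : ℕ) : Type u :=
  X.filt p i ⧸ (X.filt (p + 1) i).submoduleOf (X.filt p i)

/-- The degree `i` part `⨁_p (ℱ^p X)_i / (ℱ^{p+1} X)_i` of the linear part of `X`. -/
abbrev LinTerm (i : ℕ) : Type u :=
  DirectSum ℕ (X.LinPiece i)

/-- The restriction `(ℱ^p X)_{i+1} → (ℱ^p X)_i` of the differential of `X`. -/
noncomputable def filtDiff (i p : ℕ) :
    X.filt p (i + 1) →ₗ[MvPolynomial (Fin n) k] X.filt p i :=
  (X.d i).restrict (X.d_mem_filt p i)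

lemma filtDiff_le_comap (i p : ℕ) :
    (X.filt (p + 1) (i + 1)).submoduleOf (X.filt p (i + 1)) ≤
      ((X.filt (p + 1) i).submoduleOf (X.filt p i)).comap (X.filtDiff i p) :=
  fun v hv => X.d_mem_filt (p + 1) i v hv

/-- The differential of the linear part of `X`, induced by that of `X`. -/
noncomputable def linDiff (i : ℕ) : X.LinTerm (i + 1) →ₗ[MvPolynomial (Fin n) k] X.LinTerm i :=
  DirectSum.lmap fun p => Submodule.mapQ _ _ (X.filtDiff i p) (X.filtDiff_le_comap i p)

/-- The cycles in degree `i` of the linear part of `X`. -/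
noncomputable def linCycles : ∀ i, Submodule (MvPolynomial (Fin n) k) (X.LinTerm i)
  | 0 => ⊤
  | i + 1 => LinearMap.ker (X.linDiff i)

/-- `H_i ≠ 0` for the linear part of `X`: not every cycle is a boundary. -/
def LinHomologyNonzero (i : ℕ) : Prop :=
  ¬ X.linCycles i ≤ LinearMap.range (X.linDiff i)

/-- `sup {i | H_i(lin X) ≠ 0}`, which is `0` if the set is empty. -/
noncomputable def linearityDefect : ℕ∞ :=
  ⨆ (i : ℕ) (_ : X.LinHomologyNonzero i), (i : ℕ∞)

end MinGradedFreeRes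

/-- A (homogeneous) ideal `J` is Koszul if its linearity defect, computed from a minimal graded
free resolution, is zero. Such resolutions exist for homogeneous `J` and are unique up to
isomorphism, so the choice of the resolution is immaterial. -/
def IsKoszulIdeal (J : Ideal (MvPolynomial (Fin n) k)) : Prop :=
  ∃ X : MinGradedFreeRes J, X.linearityDefect = 0

end PolyRing

/-! `Tor_i(k, M)` is the homology of the Koszul complex of the variables with coefficients in `M`,
so it is enough that every Koszul cycle with values in `P = 𝔪^c I^(t+1)` bounds a cochain with
values in `Q = 𝔪^(c+1) I^t` (`IsKoszulVanishing`). The passage to `Tor` is a chase in the double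
complex Koszul ⊗ resolution (`exists_post_eq_diff_add_post`, `isTorVanishing_of_isKoszulVanishing`).

In the first two cases an explicit homotopy built from operators `D_j : P → Q` bounds the cycles. In
characteristic zero these are the partial derivatives composed with an inverse of the Euler operator
(`exists_diff_eq_of_euler`). For monomial ideals they are division by `x_j` without remainder
(`exists_diff_eq_of_division`). Both are skew derivations, and `I ⊆ 𝔪²` makes them send `P` into `Q`
(`skewDerivation_pow_mul_pow_mem`).

In the Koszul case, `P ⊆ 𝔪^(c+2) I^t ⊆ Q`, and the second inclusion already kills `Tor`: acyclicity
of the linear part makes the filtration of the minimal resolution exact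
(`exists_mem_filt_of_mem_range`), so cycles can be lifted along the resolution with control of the
powers of `𝔪` (`exists_eq_diff_add_post`). -/

namespace KoszulCochain

/-! ### Exterior algebra of cochains: contraction, wedge and lifting of coefficients. -/

open AlternatingMap

/-- The degree `a` part `Hom_ℤ(⋀^a ℤⁿ, A)` of the Koszul complex of a sequence of `n` elements
with coefficients in `A`. -/
abbrev Cochain (n a : ℕ) (A : Type*) [AddCommGroup A] : Type _ :=
  (Fin n → ℤ) [⋀^Fin a]→ₗ[ℤ] A

variable {n a : ℕ} {A B C : Type*} [AddCommGroup A] [AddCommGroup B] [AddCommGroup C]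

/-- Postcomposition with an additive map. -/
def post (f : A →+ B) : Cochain n a A →+ Cochain n a B where
  toFun z := f.toIntLinearMap.compAlternatingMap z
  map_zero' := by ext v; simp
  map_add' y z := by ext v; simp

@[simp] lemma post_apply (f : A →+ B) (z : Cochain n a A) (v : Fin a → Fin n → ℤ) :
    post f z v = f (z v) := rfl

lemma cochain_sum_apply {ι : Type*} (t : Finset ι) (f : ι → Cochain n a A)
    (v : Fin a → Fin n → ℤ) : (∑ i ∈ t, f i) v = ∑ i ∈ t, f i v :=
  map_sum (⟨⟨fun z : Cochain n a A => z v, rfl⟩, fun _ _ => rfl⟩ : Cochain n a A →+ A) f t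

/-- Contraction with the `j`-th basis vector. -/
def contract (j : Fin n) : Cochain n (a + 1) A →+ Cochain n a A where
  toFun z := z.curryLeft (Pi.single j 1)
  map_zero' := rfl
  map_add' _ _ := rfl

lemma contract_apply (j : Fin n) (z : Cochain n (a + 1) A) (v : Fin a → Fin n → ℤ) :
    contract j z v = z (Matrix.vecCons (Pi.single j 1) v) := rfl

lemma curryLeft_eq_sum (z : Cochain n (a + 1) A) (u : Fin n → ℤ) :
    z.curryLeft u = ∑ j, u j • contract j z := by
  conv_lhs => rw [← Finset.univ_sum_single u, map_sum]
  refine Finset.sum_congr rfl fun j _ => ?_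
  have : (Pi.single j (u j) : Fin n → ℤ) = u j • Pi.single j 1 := by
    rw [← Pi.single_smul]; simp
  rw [this, map_smul]
  rfl

lemma contract_self (j : Fin n) (z : Cochain n (a + 2) A) : contract j (contract j z) = 0 :=
  curryLeft_same z _

lemma contract_comm (j l : Fin n) (z : Cochain n (a + 2) A) :
    contract j (contract l z) = -contract l (contract j z) := by
  have h := curryLeft_same z (Pi.single j 1 + Pi.single l 1)
  rw [map_add] at h
  simp only [curryLeft_add, LinearMap.add_apply, map_add, curryLeft_same, zero_add, add_zero] at h
  rw [eq_neg_iff_add_eq_zero]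
  exact h

lemma contract_post (f : A →+ B) (j : Fin n) (z : Cochain n (a + 1) A) :
    contract j (post f z) = post f (contract j z) := rfl

lemma eq_zero_of_contract (z : Cochain n (a + 1) A) (h : ∀ j, contract j z = 0) : z = 0 := by
  ext v
  have h1 := congrArg (fun y => y (Matrix.vecTail v)) (curryLeft_eq_sum z (v 0))
  simp only [h, smul_zero, Finset.sum_const_zero, curryLeft_apply_apply] at h1
  rw [AlternatingMap.zero_apply] at h1 ⊢
  rw [← h1]
  congr 1
  exact (Matrix.cons_head_tail v).symm

/-- Exterior multiplication by the `j`-th basis covector. -/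
def wedge (j : Fin n) : Cochain n a A →+ Cochain n (a + 1) A where
  toFun y := alternatizeUncurryFin ((LinearMap.proj j : (Fin n → ℤ) →ₗ[ℤ] ℤ).smulRight y)
  map_zero' := by ext v; simp [alternatizeUncurryFin_apply]
  map_add' y z := by
    ext v
    simp [alternatizeUncurryFin_apply, Finset.sum_add_distrib]

lemma wedge_apply (j : Fin n) (y : Cochain n a A) (v : Fin (a + 1) → Fin n → ℤ) :
    wedge j y v = ∑ i : Fin (a + 1), (-1 : ℤ) ^ (i : ℕ) • v i j • y (i.removeNth v) := by
  simp [wedge, alternatizeUncurryFin_apply]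

/-- The Euler identity of the exterior algebra: it contributes the exterior degree to the eigenvalue
that the characteristic zero homotopy inverts. -/
lemma sum_wedge_contract (z : Cochain n (a + 1) A) :
    ∑ j, wedge j (contract j z) = (a + 1) • z := by
  rw [← alternatizeUncurryFin_curryLeft]
  ext v
  rw [cochain_sum_apply]
  simp only [wedge_apply, alternatizeUncurryFin_apply, curryLeft_eq_sum]
  rw [Finset.sum_comm]
  refine Finset.sum_congr rfl fun i _ => ?_
  rw [cochain_sum_apply, Finset.smul_sum]
  rfl

/-- The anticommutation relation of contraction and wedge. In the expansion of the wedge, the term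
that feeds the contracting vector to the covector gives the Kronecker delta; the others form the
wedge of the contraction, with one extra sign. -/
lemma contract_wedge (j l : Fin n) (y : Cochain n (a + 1) A) :
    contract l (wedge j y) = (if l = j then y else 0) - wedge j (contract l y) := by
  ext v
  rw [contract_apply, wedge_apply, Fin.sum_univ_succ, AlternatingMap.sub_apply, wedge_apply,
    sub_eq_add_neg, ← Finset.sum_neg_distrib]
  congr 1
  · by_cases h : l = j
    · subst h; simp
    · simp [h]
  · refine Finset.sum_congr rfl fun i _ => ?_
    have : i.succ.removeNth (Matrix.vecCons (Pi.single l 1 : Fin n → ℤ) v) =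
        Matrix.vecCons (Pi.single l 1) (i.removeNth v) := by
      ext1 m
      refine Fin.cases ?_ (fun m => ?_) m
      · simp [Fin.removeNth]
      · simp [Fin.removeNth]
    rw [this, contract_apply]
    simp [pow_succ]

lemma contract_wedge_zero (j l : Fin n) (y : Cochain n 0 A) :
    contract l (wedge j y) = if l = j then y else 0 := by
  ext v
  rw [contract_apply, wedge_apply]
  by_cases h : l = j
  · subst h; simp [Subsingleton.elim (α := Fin 0 → Fin n → ℤ) _ v]
  · simp [h]

/-- Cochains lift along maps that are onto their values. -/
lemma exists_post_eq (f : A →+ B) (z : Cochain n a B) (h : ∀ v, z v ∈ f.range) :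
    ∃ y : Cochain n a A, post f y = z := by
  let g : A →ₗ[ℤ] f.toIntLinearMap.range := f.toIntLinearMap.rangeRestrict
  have hg : Function.Surjective g := f.toIntLinearMap.surjective_rangeRestrict
  let z' : Cochain n a f.toIntLinearMap.range := z.codRestrict _ h
  -- Alternating maps are linear maps out of `⋀^a ℤⁿ`, which is free and hence projective.
  obtain ⟨l, hl⟩ := Module.projective_lifting_property g
    (exteriorPower.alternatingMapLinearEquiv z') hg
  refine ⟨l.compAlternatingMap (exteriorPower.ιMulti ℤ a), ?_⟩
  ext v
  have h1 := congrArg Subtype.val (LinearMap.congr_fun hl (exteriorPower.ιMulti ℤ a v))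
  rw [exteriorPower.alternatingMapLinearEquiv_apply_ιMulti] at h1
  exact h1

lemma exists_post_eq_of_mem_map (f : A →+ B) (P : AddSubgroup A) (z : Cochain n a B)
    (h : ∀ v, z v ∈ P.map f) :
    ∃ y : Cochain n a A, (∀ v, y v ∈ P) ∧ post f y = z := by
  obtain ⟨y, hy⟩ := exists_post_eq (f.comp P.subtype) z fun v => by
    obtain ⟨p, hp, h⟩ := h v
    exact ⟨⟨p, hp⟩, h⟩
  exact ⟨post P.subtype y, fun v => (y v).2, hy⟩

/-! ### The Koszul differential. -/

section Differential

variable {S : Type*} [CommRing S] (x : Fin n → S) [Module S A] [Module S B] [Module S C]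

/-- The Koszul differential of the sequence `x`. -/
def diff : Cochain n (a + 1) A →+ Cochain n a A where
  toFun z := ∑ j, x j • contract j z
  map_zero' := by simp
  map_add' y z := by simp [Finset.sum_add_distrib]

lemma diff_eq (z : Cochain n (a + 1) A) : diff x z = ∑ j, x j • contract j z := rfl

lemma diff_apply (z : Cochain n (a + 1) A) (v) : diff x z v = ∑ j, x j • contract j z v := by
  rw [diff_eq, cochain_sum_apply]; rfl

lemma wedge_smul (c : S) (j : Fin n) (z : Cochain n a A) :
    wedge j (c • z) = c • wedge j z := by
  ext v
  simp only [wedge_apply, AlternatingMap.smul_apply, Finset.smul_sum, smul_comm c]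

/-- Multiplications by the `x j` commute and contractions anticommute, so the terms for `(j, l)` and
`(l, j)` cancel. -/
lemma diff_diff (z : Cochain n (a + 2) A) : diff x (diff x z) = 0 := by
  ext v
  have h (j : Fin n) : contract j (diff x z) v =
      ∑ l, x l • contract j (contract l z) v := by
    rw [contract_apply, diff_apply]; rfl
  rw [diff_apply]
  simp only [h, Finset.smul_sum, AlternatingMap.zero_apply]
  rw [← Finset.sum_product', Finset.univ_product_univ]
  refine Finset.sum_involution (fun p _ => (p.2, p.1)) ?_ ?_ ?_ ?_
  · rintro ⟨j, l⟩ -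
    simp only
    rw [contract_comm, AlternatingMap.neg_apply, smul_neg, smul_neg, smul_comm, neg_add_cancel]
  · rintro ⟨j, l⟩ - h1 h2
    simp only [Prod.mk.injEq] at h2
    obtain ⟨rfl, -⟩ := h2
    exact h1 (by simp [contract_self])
  · simp
  · simp

lemma diff_post (f : A →ₗ[S] B) (z : Cochain n (a + 1) A) :
    diff x (post f.toAddMonoidHom z) = post f.toAddMonoidHom (diff x z) := by
  simp only [diff_eq, map_sum, contract_post]
  refine Finset.sum_congr rfl fun j _ => ?_
  ext v
  simp

/-- Koszul cycles; every cochain of degree `0` is one. -/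
def IsCycle : ∀ {a : ℕ}, Cochain n a A → Prop
  | 0, _ => True
  | _ + 1, z => diff x z = 0

lemma diff_mem_smul (N : Submodule S A) (z : Cochain n (a + 1) A) (hz : ∀ v, z v ∈ N) (v) :
    diff x z v ∈ Ideal.span (Set.range x) • N := by
  rw [diff_apply]
  exact Submodule.sum_mem _ fun j _ =>
    Submodule.smul_mem_smul (Ideal.subset_span ⟨j, rfl⟩) (hz _)

lemma wedge_mem (N : AddSubgroup A) (j : Fin n) (z : Cochain n a A) (hz : ∀ v, z v ∈ N) (v) :
    wedge j z v ∈ N := by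
  rw [wedge_apply]
  exact N.sum_mem fun i _ => N.zsmul_mem (N.zsmul_mem (hz _) _) _

/-- Degree `0` cochains with values in `(x) N` are boundaries. -/
lemma exists_diff_eq_of_mem_smul (N : Submodule S A) (z : Cochain n 0 A)
    (hz : ∀ v, z v ∈ Ideal.span (Set.range x) • N) :
    ∃ y : Cochain n 1 A, (∀ v, y v ∈ N) ∧ diff x y = z := by
  have h0 : ∀ b ∈ Ideal.span (Set.range x) • N, ∃ y : Cochain n 1 A, (∀ v, y v ∈ N) ∧
      ∀ v, diff x y v = b := by
    intro b hb
    refine Submodule.smul_induction_on hb ?_ ?_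
    · intro r hr m hm
      induction hr using Submodule.span_induction with
      | mem r hr =>
        obtain ⟨j, rfl⟩ := hr
        refine ⟨wedge j (constOfIsEmpty ℤ _ _ m), fun v => ?_, fun v => ?_⟩
        · exact wedge_mem N.toAddSubgroup j _ (fun _ => hm) v
        · rw [diff_apply]
          simp only [contract_wedge_zero]
          rw [Finset.sum_eq_single j]
          · simp
          · intro l _ hl; simp [hl]
          · simp
      | zero => exact ⟨0, fun v => N.zero_mem, fun v => by simp⟩
      | add r r' _ _ h h' =>
        obtain ⟨y, hy, e⟩ := h
        obtain ⟨y', hy', e'⟩ := h'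
        exact ⟨y + y', fun v => N.add_mem (hy v) (hy' v), fun v => by
          rw [map_add, AlternatingMap.add_apply, e, e', add_smul]⟩
      | smul c r _ h =>
        obtain ⟨y, hy, e⟩ := h
        refine ⟨c • y, fun v => N.smul_mem _ (hy v), fun v => ?_⟩
        have := diff_post x (LinearMap.lsmul S A c) y
        have h2 := congrArg (fun t => t v) this
        simp only [post_apply, e] at h2
        rw [smul_eq_mul, mul_smul]
        exact h2
    · rintro b b' ⟨y, hy, e⟩ ⟨y', hy', e'⟩
      exact ⟨y + y', fun v => N.add_mem (hy v) (hy' v), fun v => by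
          rw [map_add, AlternatingMap.add_apply, e, e']⟩
  obtain ⟨y, hy, e⟩ := h0 (z ![]) (hz _)
  refine ⟨y, hy, ?_⟩
  ext v
  rw [e, Subsingleton.elim v ![]]

end Differential

end KoszulCochain

/-! ### Cartan formula, homotopies and Koszul vanishing. -/

namespace KoszulCochain

variable {n a : ℕ} {A B : Type*} [AddCommGroup A] [AddCommGroup B]
  {S : Type*} [CommRing S] (x : Fin n → S) [Module S A] [Module S B]

lemma diff_wedge (j : Fin n) (y : Cochain n (a + 1) A) :
    diff x (wedge j y) = x j • y - ∑ m, x m • wedge j (contract m y) := by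
  simp only [diff_eq, contract_wedge, smul_sub, Finset.sum_sub_distrib]
  simp

/-- The Cartan-type formula for exterior multiplication by `e_j` twisted by an operator `D`
whose commutator with multiplication by `x_m` is `δ_{jm} π`. -/
lemma diff_wedge_post_add (j : Fin n) (D π : A →+ A)
    (hD : ∀ m b, D (x m • b) = x m • D b + if m = j then π b else 0)
    (z : Cochain n (a + 1) A) :
    diff x (wedge j (post D z)) + wedge j (post D (diff x z)) =
      x j • post D z + wedge j (post π (contract j z)) := by
  have h1 : post D (diff x z) =
      ∑ m, x m • post D (contract m z) + post π (contract j z) := by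
    ext v
    simp only [post_apply, diff_apply, map_sum, hD, Finset.sum_add_distrib,
      AlternatingMap.add_apply, cochain_sum_apply, AlternatingMap.smul_apply]
    simp
  rw [diff_wedge, h1, map_add, map_sum]
  simp only [wedge_smul, contract_post]
  abel

/-- Koszul vanishing from division operators `D j` by `x j` with remainders `π j`. -/
lemma exists_diff_eq_of_division (D π : Fin n → A →+ A)
    (hD : ∀ j m b, D j (x m • b) = x m • D j b + if m = j then π j b else 0)
    (hπ : ∀ j b, x j • D j b + π j b = b) (P Q : AddSubgroup A)
    (hDP : ∀ j, ∀ b ∈ P, D j b ∈ Q) (hπP : ∀ j, ∀ b ∈ P, π j b ∈ P)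
    (z : Cochain n (a + 1) A) (hz : ∀ v, z v ∈ P) (hdz : diff x z = 0) :
    ∃ y : Cochain n (a + 2) A, (∀ v, y v ∈ Q) ∧ diff x y = z := by
  -- Clear the basis vectors one at a time: modulo boundaries of `Q`-valued cochains, `z` is a cycle
  -- annihilated by contraction with every `j ∈ T`. For `T` the whole index set such a cycle is
  -- zero.
  have key : ∀ T : Finset (Fin n), ∃ (y : Cochain n (a + 2) A) (z' : Cochain n (a + 1) A),
      (∀ v, y v ∈ Q) ∧ (∀ v, z' v ∈ P) ∧ diff x z' = 0 ∧ diff x y + z' = z ∧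
        ∀ j ∈ T, contract j z' = 0 := by
    intro T
    induction T using Finset.induction_on with
    | empty => exact ⟨0, z, fun v => Q.zero_mem, hz, hdz, by simp, by simp⟩
    | insert j T _ ih =>
      obtain ⟨y, z', hy, hz', hdz', hsum, hT⟩ := ih
      have hform := diff_wedge_post_add x j (D j) (π j) (hD j) z'
      rw [hdz', map_zero, map_zero, add_zero] at hform
      -- The right-hand side involves only the remainder `π j`. Contraction with `j` kills it,
      -- because the two terms cancel, and contractions already zero stay zero.
      have hz'' : z' - diff x (wedge j (post (D j) z')) =
          post (π j) z' - wedge j (post (π j) (contract j z')) := by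
        have : x j • post (D j) z' + post (π j) z' = z' := by
          ext v; exact hπ j _
        rw [hform]
        nth_rewrite 1 [← this]
        abel
      refine ⟨y + wedge j (post (D j) z'), z' - diff x (wedge j (post (D j) z')), ?_, ?_, ?_, ?_,
        ?_⟩
      · exact fun v => Q.add_mem (hy v) (wedge_mem Q j _ (fun w => hDP j _ (hz' w)) v)
      · intro v
        rw [hz'']
        exact P.sub_mem (hπP j _ (hz' v))
          (wedge_mem P j _ (fun w => hπP j _ (hz' _)) v)
      · rw [map_sub, hdz', diff_diff, sub_zero]
      · rw [map_add, ← hsum]; abel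
      · intro l hl
        rw [hz'', map_sub, contract_post]
        cases a with
        | zero =>
          rw [contract_wedge_zero]
          by_cases hlj : l = j
          · subst hlj; simp
          · rw [hT l (Finset.mem_of_mem_insert_of_ne hl hlj)]
            simp [hlj]
        | succ a =>
          rw [contract_wedge, contract_post]
          by_cases hlj : l = j
          · subst hlj; simp [contract_self]
          · rw [contract_comm, hT l (Finset.mem_of_mem_insert_of_ne hl hlj)]
            simp [hlj]
  obtain ⟨y, z', hy, -, -, hsum, hT⟩ := key Finset.univ
  rw [eq_zero_of_contract z' fun j => hT j (Finset.mem_univ j), add_zero] at hsum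
  exact ⟨y, hy, hsum⟩

/-- Koszul vanishing from partial derivatives `D j` and an inverse `E` of the Euler operator. -/
lemma exists_diff_eq_of_euler (D : Fin n → A →+ A)
    (hD : ∀ j m b, D j (x m • b) = x m • D j b + if m = j then b else 0) (E E' : A →+ A)
    (hE' : ∀ m b, E' (x m • b) = x m • E b)
    (hE : ∀ b, ∑ j, x j • D j (E b) + ((a + 1 : ℕ) : S) • E b = b) (P Q : AddSubgroup A)
    (hDP : ∀ j, ∀ b ∈ P, D j (E b) ∈ Q)
    (z : Cochain n (a + 1) A) (hz : ∀ v, z v ∈ P) (hdz : diff x z = 0) :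
    ∃ y : Cochain n (a + 2) A, (∀ v, y v ∈ Q) ∧ diff x y = z := by
  refine ⟨∑ j, wedge j (post (D j) (post E z)), fun v => ?_, ?_⟩
  · rw [cochain_sum_apply]
    exact Q.sum_mem fun j _ => wedge_mem Q j _ (fun w => hDP j _ (hz w)) v
  -- Multiplication by `x m` shifts the Euler weight, so `E` does not commute with the differential;
  -- it is intertwined with `E'`, which suffices for cycles.
  · have h0 : diff x (post E z) = 0 := by
      have h : diff x (post E z) = post E' (diff x z) := by
        ext v
        simp only [post_apply, diff_apply, map_sum, hE', contract_post]
      rw [h, hdz, map_zero]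
    have h1 (j : Fin n) := diff_wedge_post_add x j (D j) (AddMonoidHom.id A) (hD j) (post E z)
    simp only [h0, map_zero, add_zero] at h1
    rw [map_sum, Finset.sum_congr rfl fun j _ => h1 j, Finset.sum_add_distrib]
    have h2 : ∑ j, wedge j (post (AddMonoidHom.id A) (contract j (post E z))) =
        (a + 1) • post E z := by
      rw [← sum_wedge_contract]; rfl
    rw [h2]
    ext v
    rw [AlternatingMap.add_apply, cochain_sum_apply]
    have h := hE (z v)
    rw [Nat.cast_smul_eq_nsmul] at h
    exact h

/-- The map `φ` sends every Koszul cycle to a boundary. -/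
def IsKoszulVanishing (φ : A →ₗ[S] B) : Prop :=
  ∀ (a : ℕ) (z : Cochain n a A), IsCycle x z →
    ∃ y : Cochain n (a + 1) B, diff x y = post φ.toAddMonoidHom z

/-- The Koszul complex with coefficients in `A` is exact in positive degrees. -/
def IsAcyclic (A : Type*) [AddCommGroup A] [Module S A] : Prop :=
  ∀ (a : ℕ) (z : Cochain n (a + 1) A), diff x z = 0 →
    ∃ y : Cochain n (a + 2) A, diff x y = z

lemma IsAcyclic.of_retract (i : A →ₗ[S] B) (r : B →ₗ[S] A) (h : r.comp i = LinearMap.id)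
    (hB : IsAcyclic x B) : IsAcyclic x A := by
  intro a z hz
  obtain ⟨y, hy⟩ := hB a (post i.toAddMonoidHom z) (by rw [diff_post, hz, map_zero])
  refine ⟨post r.toAddMonoidHom y, ?_⟩
  rw [diff_post, hy]
  ext v
  exact LinearMap.congr_fun h (z v)

/-- Koszul vanishing for an inclusion of submodules, from the statement about cochains with
values in an ambient module. -/
lemma isKoszulVanishing_inclusion {P Q : Submodule S A} (hPQ : P ≤ Q)
    (h0 : P ≤ Ideal.span (Set.range x) • Q)
    (h : ∀ (a : ℕ) (z : Cochain n (a + 1) A), (∀ v, z v ∈ P) → diff x z = 0 →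
      ∃ y : Cochain n (a + 2) A, (∀ v, y v ∈ Q) ∧ diff x y = z) :
    IsKoszulVanishing x (Submodule.inclusion hPQ) := by
  have h' : ∀ (a : ℕ) (z : Cochain n a A), (∀ v, z v ∈ P) → IsCycle x z →
      ∃ y : Cochain n (a + 1) A, (∀ v, y v ∈ Q) ∧ diff x y = z := by
    intro a z hz hdz
    cases a with
    | zero => exact exists_diff_eq_of_mem_smul x Q z fun v => h0 (hz v)
    | succ a => exact h a z hz hdz
  intro a z hz
  obtain ⟨y, hy, e⟩ := h' a (post P.subtype.toAddMonoidHom z) (fun v => (z v).2) (by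
    cases a with
    | zero => trivial
    | succ a =>
      have hz : diff x z = 0 := hz
      change diff x _ = 0
      rw [diff_post, hz, map_zero])
  obtain ⟨y', hy'⟩ := exists_post_eq Q.subtype.toAddMonoidHom y fun v => ⟨⟨y v, hy v⟩, rfl⟩
  refine ⟨y', ?_⟩
  ext v
  have h1 := diff_post x Q.subtype y'
  rw [hy', e] at h1
  exact (congrArg (fun t => t v) h1).symm

lemma IsKoszulVanishing.comp {P Q N : Submodule S A} (hPQ : P ≤ Q) {hQN : Q ≤ N}
    (h : IsKoszulVanishing x (Submodule.inclusion hQN)) :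
    IsKoszulVanishing x (Submodule.inclusion (hPQ.trans hQN)) := by
  intro a z hz
  refine h a (post (Submodule.inclusion hPQ).toAddMonoidHom z) ?_
  cases a with
  | zero => trivial
  | succ a =>
    have hz : diff x z = 0 := hz
    change diff x _ = 0
    rw [diff_post, hz, map_zero]

end KoszulCochain

/-! ### Skew derivations and products of ideals. -/

namespace PolyRing

open MvPolynomial KoszulCochain

section SkewDerivation

variable {R : Type*} [CommRing R] {D : R →+ R} {σ : R →+* R}

lemma map_mem_pow {I : Ideal R} (hσ : ∀ u ∈ I, σ u ∈ I) (c : ℕ) : ∀ u ∈ I ^ c, σ u ∈ I ^ c := by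
  intro u hu
  have h := Ideal.mem_map_of_mem σ hu
  rw [Ideal.map_pow] at h
  exact Ideal.pow_right_mono (Ideal.map_le_iff_le_comap.2 hσ) _ h

/-- The twisted Leibniz rule serves both homotopies: `σ = id` for partial derivatives, `σ = (x_j ↦
0)` for division by `x_j`. -/
lemma skewDerivation_mul_mem (hD : ∀ u v, D (u * v) = D u * v + σ u * D v) {I J N L : Ideal R}
    (hσ : ∀ u ∈ I, σ u ∈ I) (hI : ∀ u ∈ I, D u ∈ N) (hJ : ∀ u ∈ J, D u ∈ L) :
    ∀ u ∈ I * J, D u ∈ N * J ⊔ I * L := by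
  intro u hu
  refine Submodule.mul_induction_on hu (fun u hu v hv => ?_) fun u v hu hv => ?_
  · rw [hD]
    exact Submodule.add_mem_sup (Ideal.mul_mem_mul (hI u hu) hv)
      (Ideal.mul_mem_mul (hσ u hu) (hJ v hv))
  · rw [map_add]
    exact add_mem hu hv

lemma skewDerivation_pow_succ_mem (hD : ∀ u v, D (u * v) = D u * v + σ u * D v) {I N : Ideal R}
    (hσ : ∀ u ∈ I, σ u ∈ I) (hI : ∀ u ∈ I, D u ∈ N) (t : ℕ) :
    ∀ u ∈ I ^ (t + 1), D u ∈ N * I ^ t := by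
  induction t with
  | zero => simpa using hI
  | succ t ih =>
    intro u hu
    rw [pow_succ'] at hu
    have h := skewDerivation_mul_mem hD hσ hI ih u hu
    have e : I * (N * I ^ t) = N * I ^ (t + 1) := by ring
    rwa [e, sup_idem] at h

/-- If `D` hits the factor `m ^ c`, one power of `m` is lost, but trading a factor of `I` for `m ^
2` regains two. If `D` hits `I ^ (t + 1)`, one factor of `I` becomes a factor of `m`. -/
lemma skewDerivation_pow_mul_pow_mem (hD : ∀ u v, D (u * v) = D u * v + σ u * D v)
    {I m : Ideal R} (hm : ∀ u ∈ m, σ u ∈ m) (hσ : ∀ u ∈ I, σ u ∈ I) (hI : I ≤ m ^ 2) (c t : ℕ) :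
    ∀ u ∈ m ^ c * I ^ (t + 1), D u ∈ m ^ (c + 1) * I ^ t := by
  have hmp (c : ℕ) : ∀ u ∈ m ^ (c + 1), D u ∈ m ^ c := by
    have h := skewDerivation_pow_succ_mem hD hm (N := ⊤) (fun _ _ => trivial) c
    rwa [Ideal.top_mul] at h
  have hDI : ∀ u ∈ I, D u ∈ m := fun u hu => by simpa using hmp 1 u (hI hu)
  have hIt := skewDerivation_pow_succ_mem hD hσ hDI t
  cases c with
  | zero => simpa using hIt
  | succ c =>
    intro u hu
    refine (sup_le ?_ ?_ : m ^ c * I ^ (t + 1) ⊔ m ^ (c + 1) * (m * I ^ t) ≤ _)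
      (skewDerivation_mul_mem hD (map_mem_pow hm (c + 1)) (hmp c) hIt u hu)
    · calc m ^ c * I ^ (t + 1) = m ^ c * I * I ^ t := by ring
        _ ≤ m ^ c * m ^ 2 * I ^ t := by gcongr
        _ = m ^ (c + 1 + 1) * I ^ t := by ring
    · exact le_of_eq (by ring)

end SkewDerivation

/-! ### Division by a variable, monomial ideals and acyclicity of projectives. -/

variable {k : Type*} [Field k] {n : ℕ}

/-- The substitution `x_j ↦ 0`. -/
noncomputable def remainder (j : Fin n) : MvPolynomial (Fin n) k →+* MvPolynomial (Fin n) k :=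
  eval₂Hom C fun i => if i = j then 0 else X i

lemma remainder_X (j m : Fin n) :
    remainder j (X m : MvPolynomial (Fin n) k) = if m = j then 0 else X m :=
  eval₂Hom_X' _ _ _

lemma X_dvd_sub_remainder (j : Fin n) (u : MvPolynomial (Fin n) k) :
    X j ∣ u - remainder j u := by
  induction u using MvPolynomial.induction_on with
  | C c => simp [remainder]
  | add u v hu hv =>
    rw [map_add, add_sub_add_comm]
    exact dvd_add hu hv
  | mul_X u i hu =>
    have e : u * X i - remainder j (u * X i) =
        (u - remainder j u) * X i + remainder j u * (X i - remainder j (X i)) := by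
      rw [map_mul]; ring
    rw [e]
    refine dvd_add (hu.mul_right _) (Dvd.dvd.mul_left ?_ _)
    rw [remainder_X]
    split_ifs with h
    · subst h; simp
    · simp

/-- Division by `x_j`, dropping the remainder. -/
noncomputable def quotient (j : Fin n) : MvPolynomial (Fin n) k →+ MvPolynomial (Fin n) k :=
  AddMonoidHom.mk' (fun u => (X_dvd_sub_remainder j u).choose) fun u v => by
    refine mul_left_cancel₀ (X_ne_zero j) ?_
    rw [mul_add, ← (X_dvd_sub_remainder j u).choose_spec,
      ← (X_dvd_sub_remainder j v).choose_spec, ← (X_dvd_sub_remainder j _).choose_spec, map_add]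
    ring

lemma X_mul_quotient (j : Fin n) (u : MvPolynomial (Fin n) k) :
    X j * quotient j u = u - remainder j u :=
  (X_dvd_sub_remainder j u).choose_spec.symm

lemma quotient_mul (j : Fin n) (u v : MvPolynomial (Fin n) k) :
    quotient j (u * v) = quotient j u * v + remainder j u * quotient j v := by
  refine mul_left_cancel₀ (X_ne_zero j) ?_
  have hu := X_mul_quotient j u
  have hv := X_mul_quotient j v
  rw [X_mul_quotient, map_mul]
  linear_combination -v * hu - remainder j u * hv

lemma quotient_X_mul (j m : Fin n) (u : MvPolynomial (Fin n) k) :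
    quotient j (X m * u) = X m * quotient j u + if m = j then remainder j u else 0 := by
  refine mul_left_cancel₀ (X_ne_zero j) ?_
  have hu := X_mul_quotient j u
  rw [X_mul_quotient, map_mul]
  rw [remainder_X]
  split_ifs with h
  · subst h; linear_combination -X m * hu
  · linear_combination -X m * hu

lemma remainder_mem_idealOfVars (j : Fin n) :
    ∀ u ∈ idealOfVars (Fin n) k, remainder j u ∈ idealOfVars (Fin n) k := by
  suffices h : (idealOfVars (Fin n) k).map (remainder j) ≤ idealOfVars (Fin n) k from
    fun u hu => h (Ideal.mem_map_of_mem _ hu)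
  rw [Ideal.map_span, Ideal.span_le]
  rintro _ ⟨_, ⟨i, rfl⟩, rfl⟩
  rw [remainder_X]
  split_ifs
  · exact Ideal.zero_mem _
  · exact Ideal.subset_span ⟨i, rfl⟩

/-- The substitution `x_j ↦ 0` fixes a monomial not involving `x_j` and kills any other, so it maps
monomial generators into the ideal. -/
lemma remainder_mem_of_monomial {I : Ideal (MvPolynomial (Fin n) k)} (hI : IsMonomialIdeal I)
    (j : Fin n) : ∀ u ∈ I, remainder j u ∈ I := by
  obtain ⟨S, rfl⟩ := hI
  suffices h : (Ideal.span ((fun a => monomial a (1 : k)) '' S)).map (remainder j) ≤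
      Ideal.span ((fun a => monomial a (1 : k)) '' S) from
    fun u hu => h (Ideal.mem_map_of_mem _ hu)
  rw [Ideal.map_span, Ideal.span_le]
  rintro _ ⟨_, ⟨a, ha, rfl⟩, rfl⟩
  have e : remainder j (monomial a (1 : k)) = monomial a 1 ∨
      remainder j (monomial a (1 : k)) = 0 := by
    rw [remainder, coe_eval₂Hom, eval₂_monomial, map_one, one_mul]
    by_cases h : a j = 0
    · left
      rw [monomial_eq, C_1, one_mul]
      refine Finset.prod_congr rfl fun i hi => ?_
      have : i ≠ j := by rintro rfl; exact Finsupp.mem_support_iff.1 hi h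
      simp only [if_neg this]
    · right
      refine Finset.prod_eq_zero (Finsupp.mem_support_iff.2 h) ?_
      simp [h]
  rcases e with e | e
  · exact SetLike.mem_coe.2 (e ▸ Ideal.subset_span ⟨a, ha, rfl⟩)
  · exact SetLike.mem_coe.2 (e ▸ Ideal.zero_mem _)

/-- Division by the variables, applied coordinatewise and with no constraint on values, already
bounds every cycle. -/
lemma isAcyclic_finsupp (ι : Type*) :
    IsAcyclic (X : Fin n → MvPolynomial (Fin n) k) (ι →₀ MvPolynomial (Fin n) k) := by
  intro a z hz
  have h1 (j m : Fin n) (b : ι →₀ MvPolynomial (Fin n) k) :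
      Finsupp.mapRange.addMonoidHom (quotient j) ((X m : MvPolynomial (Fin n) k) • b) =
        (X m : MvPolynomial (Fin n) k) • Finsupp.mapRange.addMonoidHom (quotient j) b +
          if m = j then Finsupp.mapRange.addMonoidHom (remainder j).toAddMonoidHom b else 0 := by
    ext1 i
    simp only [Finsupp.mapRange.addMonoidHom_apply, Finsupp.mapRange_apply, Finsupp.coe_smul,
      Pi.smul_apply, smul_eq_mul, quotient_X_mul, Finsupp.add_apply]
    split_ifs <;> simp
  have h2 (j : Fin n) (b : ι →₀ MvPolynomial (Fin n) k) :
      (X j : MvPolynomial (Fin n) k) • Finsupp.mapRange.addMonoidHom (quotient j) b +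
        Finsupp.mapRange.addMonoidHom (remainder j).toAddMonoidHom b = b := by
    ext1 i
    simp [X_mul_quotient]
  obtain ⟨y, -, hy⟩ := exists_diff_eq_of_division X _ _ h1 h2 ⊤ ⊤
    (fun _ _ _ => trivial) (fun _ _ _ => trivial) z (fun _ => trivial) hz
  exact ⟨y, hy⟩

lemma isAcyclic_of_projective (P : Type*) [AddCommGroup P] [Module (MvPolynomial (Fin n) k) P]
    [Module.Projective (MvPolynomial (Fin n) k) P] :
    IsAcyclic (X : Fin n → MvPolynomial (Fin n) k) P := by
  obtain ⟨s, hs⟩ := Module.projective_def'.1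
    (inferInstance : Module.Projective (MvPolynomial (Fin n) k) P)
  exact IsAcyclic.of_retract X s _ hs (isAcyclic_finsupp P)

/-- The extra factor of `𝔪` on the right is what Koszul vanishing in degree `0` requires. -/
lemma pow_mul_pow_succ_le {I : Ideal (MvPolynomial (Fin n) k)}
    (hIm : I ≤ idealOfVars (Fin n) k ^ 2) (c t : ℕ) :
    idealOfVars (Fin n) k ^ c * I ^ (t + 1) ≤
      idealOfVars (Fin n) k * (idealOfVars (Fin n) k ^ (c + 1) * I ^ t) := by
  calc idealOfVars (Fin n) k ^ c * I ^ (t + 1) = idealOfVars (Fin n) k ^ c * I * I ^ t := by ring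
    _ ≤ idealOfVars (Fin n) k ^ c * idealOfVars (Fin n) k ^ 2 * I ^ t := by gcongr
    _ = _ := by ring

lemma isKoszulVanishing_of_remainder_mem {I : Ideal (MvPolynomial (Fin n) k)}
    (hI : ∀ j, ∀ u ∈ I, remainder j u ∈ I) (hIm : I ≤ idealOfVars (Fin n) k ^ 2) (c t : ℕ)
    (hle : idealOfVars (Fin n) k ^ c * I ^ (t + 1) ≤ idealOfVars (Fin n) k ^ (c + 1) * I ^ t) :
    IsKoszulVanishing X (Submodule.inclusion hle) := by
  refine isKoszulVanishing_inclusion X hle (pow_mul_pow_succ_le hIm c t) fun a z hz hdz => ?_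
  refine exists_diff_eq_of_division X quotient
    (fun j => (remainder j).toAddMonoidHom) (fun j m b => ?_) (fun j b => ?_)
    (idealOfVars (Fin n) k ^ c * I ^ (t + 1)).toAddSubgroup
    (idealOfVars (Fin n) k ^ (c + 1) * I ^ t).toAddSubgroup (fun j => ?_) (fun j => ?_) z hz hdz
  · simpa using quotient_X_mul j m b
  · simp [X_mul_quotient]
  · exact skewDerivation_pow_mul_pow_mem (σ := remainder j)
      (quotient_mul j) (remainder_mem_idealOfVars j) (hI j) hIm c t
  · intro b hb
    have h1 : (idealOfVars (Fin n) k).map (remainder j) ≤ idealOfVars (Fin n) k :=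
      Ideal.map_le_iff_le_comap.2 (remainder_mem_idealOfVars j)
    have h2 : I.map (remainder j) ≤ I := Ideal.map_le_iff_le_comap.2 (hI j)
    have h3 := Ideal.mem_map_of_mem (remainder j)
      (show b ∈ idealOfVars (Fin n) k ^ c * I ^ (t + 1) from hb)
    rw [Ideal.map_mul, Ideal.map_pow, Ideal.map_pow] at h3
    exact Ideal.mul_mono (Ideal.pow_right_mono h1 _) (Ideal.pow_right_mono h2 _) h3

/-- Consecutive powers of the graded maximal ideal. -/
lemma exists_diff_eq_of_mem_pow_succ (q : ℕ) {a : ℕ} (z : Cochain n a (MvPolynomial (Fin n) k))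
    (hz : ∀ v, z v ∈ idealOfVars (Fin n) k ^ (q + 1))
    (hdz : IsCycle (X : Fin n → MvPolynomial (Fin n) k) z) :
    ∃ y : Cochain n (a + 1) (MvPolynomial (Fin n) k),
      (∀ v, y v ∈ idealOfVars (Fin n) k ^ q) ∧
        diff (X : Fin n → MvPolynomial (Fin n) k) y = z := by
  cases a with
  | zero =>
    rw [pow_succ'] at hz
    exact exists_diff_eq_of_mem_smul X (idealOfVars (Fin n) k ^ q) z hz
  | succ a =>
    refine exists_diff_eq_of_division X quotient
      (fun j => (remainder j).toAddMonoidHom) (fun j m b => ?_) (fun j b => ?_)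
      (idealOfVars (Fin n) k ^ (q + 1)).toAddSubgroup
      (idealOfVars (Fin n) k ^ q).toAddSubgroup (fun j => ?_) 
      (fun j => map_mem_pow (remainder_mem_idealOfVars j) (q + 1)) z hz hdz
    · simpa using quotient_X_mul j m b
    · simp [X_mul_quotient]
    · have h := skewDerivation_pow_succ_mem (D := quotient j) (σ := remainder j)
        (quotient_mul (k := k) j) (remainder_mem_idealOfVars j) (N := ⊤) (fun _ _ => trivial) q
      rwa [Ideal.top_mul] at h

/-! ### Characteristic zero: partial derivatives and the Euler operator. -/

section CharZero

/-- The operator `x^b ↦ (|b| + a)⁻¹ x^b`. -/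
noncomputable def eulerInv (a : ℕ) : MvPolynomial (Fin n) k →ₗ[k] MvPolynomial (Fin n) k :=
  (basisMonomials (Fin n) k).constr k fun b => ((b.degree + a : ℕ) : k)⁻¹ • monomial b 1

lemma eulerInv_monomial (a : ℕ) (b : Fin n →₀ ℕ) (c : k) :
    eulerInv a (monomial b c) = ((b.degree + a : ℕ) : k)⁻¹ • monomial b c := by
  have h : monomial b c = c • basisMonomials (Fin n) k b := by
    simp [coe_basisMonomials, smul_monomial]
  rw [h, map_smul, eulerInv, Module.Basis.constr_basis, coe_basisMonomials, smul_comm]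

/-- `eulerInv` as an additive map. -/
noncomputable def eulerInvHom (a : ℕ) : MvPolynomial (Fin n) k →+ MvPolynomial (Fin n) k :=
  (eulerInv a).toAddMonoidHom

lemma eulerInvHom_monomial (a : ℕ) (b : Fin n →₀ ℕ) (c : k) :
    eulerInvHom a (monomial b c) = ((b.degree + a : ℕ) : k)⁻¹ • monomial b c :=
  eulerInv_monomial a b c

/-- The partial derivative as an additive map. -/
noncomputable def partialDeriv (j : Fin n) : MvPolynomial (Fin n) k →+ MvPolynomial (Fin n) k :=
  AddMonoidHom.mk' (pderiv j) (map_add _)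

lemma partialDeriv_apply (j : Fin n) (u : MvPolynomial (Fin n) k) :
    partialDeriv j u = pderiv j u := rfl

lemma partialDeriv_mul (j : Fin n) (u v : MvPolynomial (Fin n) k) :
    partialDeriv j (u * v) = partialDeriv j u * v + u * partialDeriv j v := by
  change pderiv j (u * v) = pderiv j u * v + u * pderiv j v
  rw [Derivation.leibniz, smul_eq_mul, smul_eq_mul]
  ring

lemma partialDeriv_X_mul (j m : Fin n) (u : MvPolynomial (Fin n) k) :
    partialDeriv j (X m * u) = X m * partialDeriv j u + if m = j then u else 0 := by
  have h : partialDeriv j (X m : MvPolynomial (Fin n) k) = if m = j then 1 else 0 := by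
    change pderiv j (X m) = _
    rw [pderiv_X, Pi.single_apply]
  rw [partialDeriv_mul, h, add_comm, ite_mul, one_mul, zero_mul]

/-- Multiplication by a variable raises the polynomial degree by one, which the shift parameter
absorbs. -/
lemma eulerInv_X_mul (a : ℕ) (m : Fin n) (u : MvPolynomial (Fin n) k) :
    eulerInvHom a ((X m : MvPolynomial (Fin n) k) • u) =
      (X m : MvPolynomial (Fin n) k) • eulerInvHom (a + 1) u := by
  induction u using MvPolynomial.induction_on' with
  | monomial b c =>
    rw [smul_eq_mul, smul_eq_mul, X, monomial_mul, eulerInvHom_monomial, eulerInvHom_monomial,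
      mul_smul_comm, monomial_mul]
    congr 3
    simp [add_comm, add_assoc]
  | add u v hu hv => simp only [smul_add, map_add, hu, hv]

/-- On a monomial of degree `e` the Euler operator plus `a + 1` acts as the scalar `e + a + 1`,
which is invertible in characteristic zero. -/
lemma euler_eulerInv [CharZero k] (a : ℕ) (u : MvPolynomial (Fin n) k) :
    ∑ j, (X j : MvPolynomial (Fin n) k) • partialDeriv j (eulerInvHom (a + 1) u) +
      ((a + 1 : ℕ) : MvPolynomial (Fin n) k) • eulerInvHom (a + 1) u = u := by
  induction u using MvPolynomial.induction_on' with
  | monomial b c =>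
    have h0 : ((b.degree + (a + 1) : ℕ) : k) ≠ 0 := Nat.cast_ne_zero.2 (by omega)
    rw [Nat.cast_smul_eq_nsmul, eulerInvHom_monomial, Finset.sum_congr rfl fun j _ => by
      rw [smul_monomial, smul_eq_mul, partialDeriv_apply, X_mul_pderiv_monomial],
      ← Finset.sum_smul, ← Finsupp.degree_eq_sum,
      ← smul_monomial, ← add_smul, ← Nat.cast_smul_eq_nsmul k, smul_smul, mul_inv_cancel₀ h0,
      one_smul]
  | add u v hu hv =>
    nth_rewrite 3 [← hu]
    nth_rewrite 3 [← hv]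
    simp only [map_add, smul_add, Finset.sum_add_distrib]
    abel

lemma eulerInv_of_isHomogeneous (a e : ℕ) (u : MvPolynomial (Fin n) k) (hu : u.IsHomogeneous e) :
    eulerInvHom a u = ((e + a : ℕ) : k)⁻¹ • u := by
  rw [u.as_sum, map_sum, Finset.smul_sum]
  refine Finset.sum_congr rfl fun b hb => ?_
  rw [eulerInvHom_monomial, hu.degree_eq_sum_deg_support hb, Finsupp.degree_apply]

/-- The operator rescales each homogeneous component by a constant, and a homogeneous ideal contains
the components of its elements. -/
lemma eulerInv_mem {I : Ideal (MvPolynomial (Fin n) k)} (hI : IsHomogeneousIdeal I) (a : ℕ)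
    (u : MvPolynomial (Fin n) k) (hu : u ∈ I) : eulerInvHom a u ∈ I := by
  rw [← sum_homogeneousComponent u, map_sum]
  refine I.sum_mem fun e _ => ?_
  rw [eulerInv_of_isHomogeneous a e _ (homogeneousComponent_isHomogeneous e u), smul_eq_C_mul]
  exact I.mul_mem_left _ ((mem_iff_homogeneousComponent_mem hI u).1 hu e)

lemma IsHomogeneousIdeal.mul {I J : Ideal (MvPolynomial (Fin n) k)} (hI : IsHomogeneousIdeal I)
    (hJ : IsHomogeneousIdeal J) : IsHomogeneousIdeal (I * J) :=
  let _ := MvPolynomial.gradedAlgebra (σ := Fin n) (R := k)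
  Ideal.IsHomogeneous.mul hI hJ

lemma IsHomogeneousIdeal.pow {I : Ideal (MvPolynomial (Fin n) k)} (hI : IsHomogeneousIdeal I)
    (t : ℕ) : IsHomogeneousIdeal (I ^ t) := by
  induction t with
  | zero =>
    let _ := MvPolynomial.gradedAlgebra (σ := Fin n) (R := k)
    rw [pow_zero, Ideal.one_eq_top]
    exact Ideal.IsHomogeneous.top _
  | succ t ih => rw [pow_succ]; exact ih.mul hI

lemma isHomogeneousIdeal_idealOfVars : IsHomogeneousIdeal (idealOfVars (Fin n) k) := by
  let _ := MvPolynomial.gradedAlgebra (σ := Fin n) (R := k)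
  refine Ideal.homogeneous_span _ _ ?_
  rintro _ ⟨i, rfl⟩
  exact ⟨1, isHomogeneous_X k i⟩

lemma isKoszulVanishing_of_charZero [CharZero k] {I : Ideal (MvPolynomial (Fin n) k)}
    (hI : IsHomogeneousIdeal I) (hIm : I ≤ idealOfVars (Fin n) k ^ 2) (c t : ℕ)
    (hle : idealOfVars (Fin n) k ^ c * I ^ (t + 1) ≤ idealOfVars (Fin n) k ^ (c + 1) * I ^ t) :
    IsKoszulVanishing X (Submodule.inclusion hle) := by
  refine isKoszulVanishing_inclusion X hle (pow_mul_pow_succ_le hIm c t) fun a z hz hdz => ?_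
  have hmem (j : Fin n) (b : MvPolynomial (Fin n) k)
      (hb : b ∈ idealOfVars (Fin n) k ^ c * I ^ (t + 1)) :
      partialDeriv j (eulerInvHom (a + 1) b) ∈ idealOfVars (Fin n) k ^ (c + 1) * I ^ t :=
    skewDerivation_pow_mul_pow_mem (σ := RingHom.id _) (partialDeriv_mul j)
      (fun _ h => h) (fun _ h => h) hIm c t _
      (eulerInv_mem ((isHomogeneousIdeal_idealOfVars.pow c).mul (hI.pow (t + 1))) _ _ hb)
  refine exists_diff_eq_of_euler X partialDeriv ?_ (eulerInvHom (a + 1)) (eulerInvHom a) ?_ ?_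
    (idealOfVars (Fin n) k ^ c * I ^ (t + 1)).toAddSubgroup
    (idealOfVars (Fin n) k ^ (c + 1) * I ^ t).toAddSubgroup ?_ z hz hdz
  · exact partialDeriv_X_mul
  · exact eulerInv_X_mul a
  · exact euler_eulerInv a
  · exact hmem

end CharZero

end PolyRing

/-! ### Koszul ideals: lifting along a resolution with acyclic linear part. -/

namespace PolyRing

open MvPolynomial KoszulCochain

variable {k : Type*} [Field k] {n : ℕ}

lemma mem_smul_top_pi_iff {R : Type*} [CommRing R] {r : ℕ} (I : Ideal R) (v : Fin r → R) :
    v ∈ I • (⊤ : Submodule R (Fin r → R)) ↔ ∀ c, v c ∈ I := by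
  constructor
  · intro h c
    refine Submodule.smul_induction_on h (fun a ha w _ => ?_) fun v w hv hw => ?_
    · exact I.mul_mem_right _ ha
    · exact I.add_mem hv hw
  · intro h
    rw [pi_eq_sum_univ v]
    exact Submodule.sum_mem _ fun c _ => Submodule.smul_mem_smul (h c) trivial

lemma exists_diff_eq_of_mem_pow_succ_smul_top (q : ℕ) {a r : ℕ}
    (z : Cochain n a (Fin r → MvPolynomial (Fin n) k))
    (hz : ∀ v, z v ∈ idealOfVars (Fin n) k ^ (q + 1) •
      (⊤ : Submodule (MvPolynomial (Fin n) k) (Fin r → MvPolynomial (Fin n) k)))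
    (hdz : IsCycle (X : Fin n → MvPolynomial (Fin n) k) z) :
    ∃ y : Cochain n (a + 1) (Fin r → MvPolynomial (Fin n) k),
      (∀ v, y v ∈ idealOfVars (Fin n) k ^ q •
        (⊤ : Submodule (MvPolynomial (Fin n) k) (Fin r → MvPolynomial (Fin n) k))) ∧
        diff (X : Fin n → MvPolynomial (Fin n) k) y = z := by
  have h (c : Fin r) : ∃ y : Cochain n (a + 1) (MvPolynomial (Fin n) k),
      (∀ v, y v ∈ idealOfVars (Fin n) k ^ q) ∧
        diff (X : Fin n → MvPolynomial (Fin n) k) y = post (LinearMap.proj (R :=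
          MvPolynomial (Fin n) k) (φ := fun _ => MvPolynomial (Fin n) k) c).toAddMonoidHom z := by
    refine exists_diff_eq_of_mem_pow_succ q _ (fun v => (mem_smul_top_pi_iff _ _).1 (hz v) c) ?_
    cases a with
    | zero => trivial
    | succ a =>
      have hdz : diff _ z = 0 := hdz
      change diff _ _ = 0
      rw [diff_post, hdz, map_zero]
  choose y hy e using h
  refine ⟨∑ c, post (LinearMap.single (MvPolynomial (Fin n) k)
    (fun _ => MvPolynomial (Fin n) k) c).toAddMonoidHom (y c), fun v => ?_, ?_⟩
  · rw [cochain_sum_apply, mem_smul_top_pi_iff]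
    intro c
    rw [Finset.sum_apply]
    refine Ideal.sum_mem _ fun c' _ => ?_
    change (Pi.single c' (y c' v) : Fin r → MvPolynomial (Fin n) k) c ∈ _
    rw [Pi.single_apply]
    split_ifs
    · exact hy c' v
    · exact Ideal.zero_mem _
  · rw [map_sum]
    simp only [diff_post, e]
    ext1 v
    rw [cochain_sum_apply]
    exact Finset.univ_sum_single (z v)

/-- Cochains whose Koszul differential has values in `P`; this is no condition in degree `0`. -/
def IsCycleModulo {R A : Type*} [CommRing R] [AddCommGroup A] [Module R A] (x : Fin n → R)
    (P : Submodule R A) : ∀ {a : ℕ}, Cochain n a A → Prop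
  | 0, _ => True
  | _ + 1, z => ∀ v, diff x z v ∈ P

namespace MinGradedFreeRes

variable {J : Ideal (MvPolynomial (Fin n) k)} (F : MinGradedFreeRes J)

lemma filt_zero (i : ℕ) : F.filt 0 i = ⊤ := by
  rw [filt, Nat.zero_sub, pow_zero, Submodule.one_smul]

lemma filt_succ_le (p i : ℕ) : F.filt (p + 1) i ≤ F.filt p i :=
  Submodule.smul_mono_left (Ideal.pow_le_pow_right (by omega))

/-- A supremum equal to `0` says nothing about `H_0`, but it forces the homology in every degree `i
+ 1` to vanish. -/
lemma ker_linDiff_le (hF : F.linearityDefect = 0) (i : ℕ) :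
    LinearMap.ker (F.linDiff i) ≤ LinearMap.range (F.linDiff (i + 1)) := by
  by_contra h
  have h1 : ((i + 1 : ℕ) : ℕ∞) ≤ F.linearityDefect :=
    le_iSup₂_of_le (f := fun (i : ℕ) (_ : F.LinHomologyNonzero i) => (i : ℕ∞)) (i + 1) h le_rfl
  rw [hF] at h1
  simp at h1

/-- If the linear part of `F` is acyclic, then the subcomplexes of the filtration are exact
wherever `F` is. -/
lemma exists_mem_filt_of_mem_range (hF : F.linearityDefect = 0) (p i : ℕ) (v)
    (hv : v ∈ F.filt p i) (hr : v ∈ LinearMap.range (F.d i)) :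
    ∃ w ∈ F.filt p (i + 1), F.d i w = v := by
  induction p with
  | zero =>
    obtain ⟨w, hw⟩ := hr
    exact ⟨w, by rw [filt_zero]; trivial, hw⟩
  | succ p ih =>
    obtain ⟨w, hw, e⟩ := ih (F.filt_succ_le p i hv)
    -- Since `d w = v` lies one filtration step deeper, the class of `w` is a cycle of the linear
    -- part. It is therefore the boundary of some class `u`, and replacing `w` by `w - d u` gains
    -- the missing power without changing the image.
    let c : F.LinPiece (i + 1) p := Submodule.Quotient.mk ⟨w, hw⟩
    have hc : DirectSum.lof (MvPolynomial (Fin n) k) ℕ (F.LinPiece (i + 1)) p c ∈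
        LinearMap.ker (F.linDiff i) := by
      rw [LinearMap.mem_ker, linDiff, DirectSum.lmap_lof]
      have h0 : Submodule.mapQ _ _ (F.filtDiff i p) (F.filtDiff_le_comap i p) c = 0 := by
        refine (Submodule.Quotient.mk_eq_zero _).2 ?_
        change F.d i w ∈ F.filt (p + 1) i
        rwa [e]
      rw [h0, map_zero]
    obtain ⟨y, hy⟩ := F.ker_linDiff_le hF i hc
    have hyp := congrArg (fun t => t p) hy
    simp only [linDiff, DirectSum.lmap_apply, DirectSum.lof_apply] at hyp
    obtain ⟨u, hu⟩ := Submodule.Quotient.mk_surjective _ (y p)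
    rw [← hu, Submodule.mapQ_apply] at hyp
    have hdiff := (Submodule.Quotient.eq _).1 hyp
    have hdiff' : F.d (i + 1) u - w ∈ F.filt (p + 1) (i + 1) := hdiff
    refine ⟨w - F.d (i + 1) u, ?_, ?_⟩
    · rw [← neg_sub]
      exact neg_mem hdiff'
    · rw [map_sub, e, (F.exact_succ i).apply_apply_eq_zero, sub_zero]

/-- Induction on the exterior degree. The Koszul differential of `z` has coefficients in `𝔪^(q+2)`
and in the image of `d`, so exactness of the filtration lifts it to `z'` with coefficients in
`𝔪^(q+1)`, one resolution step higher and one exterior degree lower. Decomposing `z'` with first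
part `y₁`, the cochain `z - d y₁` is an honest Koszul cycle; by minimality its coefficients still
lie in `𝔪^(q+1)`, so it bounds with coefficients in `𝔪^q`. -/
lemma exists_eq_diff_add_post (hF : F.linearityDefect = 0) (q : ℕ) {a : ℕ} :
    ∀ (b : ℕ) (z : Cochain n a (Fin (F.rank b) → MvPolynomial (Fin n) k)),
      (∀ v, z v ∈ idealOfVars (Fin n) k ^ (q + 1) •
        (⊤ : Submodule (MvPolynomial (Fin n) k) (Fin (F.rank b) → MvPolynomial (Fin n) k))) →
      IsCycleModulo X (LinearMap.range (F.d b)) z →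
      ∃ (y : Cochain n (a + 1) (Fin (F.rank b) → MvPolynomial (Fin n) k))
        (w : Cochain n a (Fin (F.rank (b + 1)) → MvPolynomial (Fin n) k)),
        (∀ v, y v ∈ idealOfVars (Fin n) k ^ q •
          (⊤ : Submodule (MvPolynomial (Fin n) k) (Fin (F.rank b) → MvPolynomial (Fin n) k))) ∧
        (∀ v, w v ∈ idealOfVars (Fin n) k ^ q • (⊤ : Submodule (MvPolynomial (Fin n) k)
          (Fin (F.rank (b + 1)) → MvPolynomial (Fin n) k))) ∧
        z = diff (X : Fin n → MvPolynomial (Fin n) k) y + post (F.d b).toAddMonoidHom w := by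
  induction a with
  | zero =>
    intro b z hz _
    obtain ⟨y, hy, e⟩ := exists_diff_eq_of_mem_pow_succ_smul_top q z hz trivial
    exact ⟨y, 0, hy, fun v => Submodule.zero_mem _, by rw [e, map_zero, add_zero]⟩
  | succ a ih =>
    intro b z hz hdz
    have hdz : ∀ v, diff (X : Fin n → MvPolynomial (Fin n) k) z v ∈ LinearMap.range (F.d b) := hdz
    have hlift (v) : diff (X : Fin n → MvPolynomial (Fin n) k) z v ∈
        (idealOfVars (Fin n) k ^ (q + 1) • (⊤ : Submodule (MvPolynomial (Fin n) k)
          (Fin (F.rank (b + 1)) → MvPolynomial (Fin n) k))).toAddSubgroup.map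
            (F.d b).toAddMonoidHom := by
      have h1 := diff_mem_smul X _ z hz v
      rw [← Submodule.mul_smul, ← pow_succ'] at h1
      -- `filt p b` is `𝔪^(p-b)` times the free module, so this index means `𝔪^(q+2)` in degree `b`
      -- and `𝔪^(q+1)` in degree `b + 1`.
      obtain ⟨w, hw, e⟩ := F.exists_mem_filt_of_mem_range hF (q + 1 + 1 + b) b _
        (by rw [filt, Nat.add_sub_cancel]; exact h1) (hdz v)
      rw [filt, show q + 1 + 1 + b - (b + 1) = q + 1 by omega] at hw
      exact ⟨w, hw, e⟩
    obtain ⟨z', hz', e⟩ := exists_post_eq_of_mem_map _ _ _ hlift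
    have hz'' : IsCycleModulo X (LinearMap.range (F.d (b + 1))) z' := by
      cases a with
      | zero => trivial
      | succ a =>
        intro v
        refine ((F.exact_succ b) _).1 ?_
        have h1 := diff_post (X : Fin n → MvPolynomial (Fin n) k) (F.d b) z'
        rw [e, diff_diff] at h1
        exact (congrArg (fun t => t v) h1).symm
    obtain ⟨y₁, w₁, hy₁, -, e₁⟩ := ih (b + 1) z' hz' hz''
    have hmem (v) : F.d b (y₁ v) ∈ idealOfVars (Fin n) k ^ (q + 1) •
        (⊤ : Submodule (MvPolynomial (Fin n) k) (Fin (F.rank b) → MvPolynomial (Fin n) k)) := by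
      have h1 := F.d_mem_filt (q + 1 + b) b (y₁ v) (by
        rw [filt, show q + 1 + b - (b + 1) = q by omega]; exact hy₁ v)
      rwa [filt, Nat.add_sub_cancel] at h1
    have hcyc : diff (X : Fin n → MvPolynomial (Fin n) k)
        (z - post (F.d b).toAddMonoidHom y₁) = 0 := by
      have h0 : post (F.d b).toAddMonoidHom (post (F.d (b + 1)).toAddMonoidHom w₁) = 0 := by
        ext1 v
        exact (F.exact_succ b).apply_apply_eq_zero _
      rw [map_sub, diff_post, ← e, e₁, map_add, h0, add_zero, sub_self]
    obtain ⟨y, hy, ey⟩ := exists_diff_eq_of_mem_pow_succ_smul_top q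
      (z - post (F.d b).toAddMonoidHom y₁) (fun v => Submodule.sub_mem _ (hz v) (hmem v)) hcyc
    exact ⟨y, y₁, hy, hy₁, by rw [ey, sub_add_cancel]⟩

/-- Lift the cycle through the augmentation to a cochain on `F_0`, which is a cycle modulo the image
of `d 0`; after decomposing it, the augmentation kills the part coming from `F_1`. -/
lemma isKoszulVanishing (hF : F.linearityDefect = 0) (q : ℕ)
    (hle : idealOfVars (Fin n) k ^ (q + 1) * J ≤ idealOfVars (Fin n) k ^ q * J) :
    IsKoszulVanishing X (Submodule.inclusion hle) := by
  refine isKoszulVanishing_inclusion X hle (le_of_eq ?_) fun a z hz hdz => ?_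
  · rw [smul_eq_mul, pow_succ', mul_assoc]
  · let ε : (Fin (F.rank 0) → MvPolynomial (Fin n) k) →ₗ[MvPolynomial (Fin n) k]
      MvPolynomial (Fin n) k := J.subtype.comp F.aug
    have hmap (c : ℕ) : (idealOfVars (Fin n) k ^ c • (⊤ : Submodule (MvPolynomial (Fin n) k)
        (Fin (F.rank 0) → MvPolynomial (Fin n) k))).map ε = idealOfVars (Fin n) k ^ c * J := by
      rw [Submodule.map_smul'', Submodule.map_top, LinearMap.range_comp,
        LinearMap.range_eq_top.2 F.aug_surjective, Submodule.map_top, Submodule.range_subtype]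
      rfl
    obtain ⟨z₀, hz₀, e⟩ := exists_post_eq_of_mem_map ε.toAddMonoidHom
      (idealOfVars (Fin n) k ^ (q + 1) • (⊤ : Submodule (MvPolynomial (Fin n) k)
        (Fin (F.rank 0) → MvPolynomial (Fin n) k))).toAddSubgroup z (fun v => by
          have h1 := hz v
          rw [← hmap] at h1
          exact h1)
    have hcyc : IsCycleModulo X (LinearMap.range (F.d 0)) z₀ := by
      intro v
      refine (F.exact_zero _).1 (Subtype.ext ?_)
      have h1 := diff_post (X : Fin n → MvPolynomial (Fin n) k) ε z₀
      rw [e, hdz] at h1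
      exact (congrArg (fun t => t v) h1).symm
    obtain ⟨y, w, hy, -, e'⟩ := F.exists_eq_diff_add_post hF q 0 z₀ hz₀ hcyc
    refine ⟨post ε.toAddMonoidHom y, fun v => ?_, ?_⟩
    · rw [← hmap]
      exact Submodule.mem_map_of_mem (hy v)
    · have h0 : post ε.toAddMonoidHom (post (F.d 0).toAddMonoidHom w) = 0 := by
        ext1 v
        exact congrArg Subtype.val (F.exact_zero.apply_apply_eq_zero (w v))
      rw [diff_post, ← e, e', map_add, h0, add_zero]

end MinGradedFreeRes

/-- The inclusion factors through `𝔪^(c+2) I^t`, because `I ⊆ 𝔪²`, and the second factor already has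
the vanishing property. -/
lemma isKoszulVanishing_of_isKoszulIdeal {I : Ideal (MvPolynomial (Fin n) k)}
    (hIm : I ≤ idealOfVars (Fin n) k ^ 2) (c t : ℕ) (hI : 1 ≤ t → IsKoszulIdeal (I ^ t))
    (hle : idealOfVars (Fin n) k ^ c * I ^ (t + 1) ≤ idealOfVars (Fin n) k ^ (c + 1) * I ^ t) :
    IsKoszulVanishing X (Submodule.inclusion hle) := by
  have h1 : idealOfVars (Fin n) k ^ c * I ^ (t + 1) ≤
      idealOfVars (Fin n) k ^ (c + 1 + 1) * I ^ t := by
    refine (pow_mul_pow_succ_le hIm c t).trans (le_of_eq ?_)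
    ring
  have h2 : idealOfVars (Fin n) k ^ (c + 1 + 1) * I ^ t ≤
      idealOfVars (Fin n) k ^ (c + 1) * I ^ t :=
    Ideal.mul_mono_left (Ideal.pow_le_pow_right (Nat.le_succ _))
  refine IsKoszulVanishing.comp X h1 (hQN := h2) ?_
  cases t with
  | zero =>
    -- The power `I^0 = R` is outside the Koszul hypothesis; consecutive powers of `𝔪` are handled
    -- by division.
    have hone : I ^ 0 = 1 := pow_zero I
    refine isKoszulVanishing_inclusion X h2 (le_of_eq ?_) fun a z hz hdz => ?_
    · rw [smul_eq_mul, pow_succ' _ (c + 1), mul_assoc]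
    · rw [hone, mul_one] at *
      exact exists_diff_eq_of_mem_pow_succ (c + 1) z hz hdz
  | succ t =>
    obtain ⟨F, hF⟩ := hI (by omega)
    exact F.isKoszulVanishing hF (c + 1) h2

end PolyRing

/-! ### From Koszul vanishing to resolutions: the double complex chase. -/

section

open CategoryTheory MonoidalCategory

namespace KoszulCochain

section Chase

variable {n : ℕ} {S : Type*} [CommRing S] (x : Fin n → S) {M N : Type*} [AddCommGroup M]
  [AddCommGroup N] [Module S M] [Module S N] {P Q : ℕ → Type*} [∀ b, AddCommGroup (P b)]
  [∀ b, AddCommGroup (Q b)] [∀ b, Module S (P b)] [∀ b, Module S (Q b)]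
  (dP : ∀ b, P (b + 1) →ₗ[S] P b) (εP : P 0 →ₗ[S] M)
  (dQ : ∀ b, Q (b + 1) →ₗ[S] Q b) (εQ : Q 0 →ₗ[S] N)

/-- Cochains with coefficients in a term of a resolution whose differential is a boundary. -/
def LiftsToTotal : ∀ (b : ℕ) {a : ℕ}, Cochain n a (P b) → Prop
  | 0, _, u => IsCycle x (post εP.toAddMonoidHom u)
  | b + 1, a, u => ∃ u' : Cochain n (a + 1) (P b), diff x u' = post (dP b).toAddMonoidHom u

variable {dP εP dQ εQ} {φ : M →ₗ[S] N} {Φ : ∀ b, P b →ₗ[S] Q b}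

/-- A staircase induction on the resolution degree. At the bottom, the Koszul vanishing of `φ`
bounds the augmented cycle, and the bound lifts to `Q 0`. Above, acyclicity of the `P b` continues
the staircase down to the augmentation, and the correction `w` found one step below serves as `y`,
with exactness of `Q` supplying the next one. -/
lemma exists_post_eq_diff_add_post (hP : ∀ b, IsAcyclic x (P b))
    (hdd : ∀ b v, dP b (dP (b + 1) v) = 0) (hεd : ∀ v, εP (dP 0 v) = 0)
    (hεQ : Function.Surjective εQ) (hQ0 : Function.Exact (dQ 0) εQ)
    (hQ : ∀ b, Function.Exact (dQ (b + 1)) (dQ b))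
    (hΦ : ∀ b v, dQ b (Φ (b + 1) v) = Φ b (dP b v)) (hΦ0 : ∀ v, εQ (Φ 0 v) = φ (εP v))
    (hφ : IsKoszulVanishing x φ) (b : ℕ) :
    ∀ (a : ℕ) (u : Cochain n a (P b)), LiftsToTotal x dP εP b u →
      ∃ (y : Cochain n (a + 1) (Q b)) (w : Cochain n a (Q (b + 1))),
        post (Φ b).toAddMonoidHom u = diff x y + post (dQ b).toAddMonoidHom w := by
  induction b with
  | zero =>
    intro a u hu
    obtain ⟨y, hy⟩ := hφ a _ hu
    obtain ⟨y', rfl⟩ := exists_post_eq εQ.toAddMonoidHom y fun v => hεQ _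
    obtain ⟨w, hw⟩ := exists_post_eq (dQ 0).toAddMonoidHom
      (post (Φ 0).toAddMonoidHom u - diff x y') fun v => by
        refine (hQ0 _).1 ?_
        rw [diff_post] at hy
        have h1 := congrArg (fun t => t v) hy
        change εQ (Φ 0 (u v) - diff x y' v) = 0
        rw [map_sub, hΦ0, sub_eq_zero]
        exact h1.symm
    exact ⟨y', w, by rw [hw, add_sub_cancel]⟩
  | succ b ih =>
    rintro a u ⟨u', hu'⟩
    have hlift : LiftsToTotal x dP εP b u' := by
      cases b with
      | zero =>
        change diff x (post εP.toAddMonoidHom u') = 0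
        rw [diff_post, hu']
        ext1 v
        exact hεd _
      | succ b =>
        obtain ⟨u'', hu''⟩ := hP b a (post (dP b).toAddMonoidHom u') (by
          rw [diff_post, hu']
          ext1 v
          exact hdd b _)
        exact ⟨u'', hu''⟩
    obtain ⟨y, w, e⟩ := ih (a + 1) u' hlift
    obtain ⟨w', hw'⟩ := exists_post_eq (dQ (b + 1)).toAddMonoidHom
      (post (Φ (b + 1)).toAddMonoidHom u - diff x w) fun v => by
        refine (hQ b _).1 ?_
        change dQ b (Φ (b + 1) (u v) - diff x w v) = 0
        rw [map_sub, hΦ, sub_eq_zero]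
        have h1 := congrArg (diff x) e
        rw [diff_post, hu', map_add, diff_diff, zero_add, diff_post] at h1
        exact congrArg (fun t => t v) h1
    exact ⟨w, w', by rw [hw', add_sub_cancel]⟩

/-- Exterior degree `0` of the chase: a cycle modulo the ideal `(x)` starts a staircase, and the
Koszul boundary in the conclusion has values in `(x) Q`. The cast in `hu` leaves no condition when
`b = 0`. -/
lemma exists_sub_mem_smul_top (hP : ∀ b, IsAcyclic x (P b))
    (hdd : ∀ b v, dP b (dP (b + 1) v) = 0) (hεd : ∀ v, εP (dP 0 v) = 0)
    (hεQ : Function.Surjective εQ) (hQ0 : Function.Exact (dQ 0) εQ)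
    (hQ : ∀ b, Function.Exact (dQ (b + 1)) (dQ b))
    (hΦ : ∀ b v, dQ b (Φ (b + 1) v) = Φ b (dP b v)) (hΦ0 : ∀ v, εQ (Φ 0 v) = φ (εP v))
    (hφ : IsKoszulVanishing x φ) (b : ℕ) (u : P b)
    (hu : ∀ c (h : b = c + 1), dP c (h ▸ u) ∈ Ideal.span (Set.range x) • (⊤ : Submodule S (P c))) :
    ∃ w : Q (b + 1), Φ b u - dQ b w ∈ Ideal.span (Set.range x) • (⊤ : Submodule S (Q b)) := by
  obtain ⟨y, w, e⟩ := exists_post_eq_diff_add_post x hP hdd hεd hεQ hQ0 hQ hΦ hΦ0 hφ b 0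
    (AlternatingMap.constOfIsEmpty ℤ _ _ u) (by
      cases b with
      | zero => trivial
      | succ b =>
        obtain ⟨y, -, hy⟩ := exists_diff_eq_of_mem_smul x ⊤
          (post (dP b).toAddMonoidHom (AlternatingMap.constOfIsEmpty ℤ (Fin n → ℤ) (Fin 0) u))
          fun v => hu b rfl
        exact ⟨y, hy⟩)
  refine ⟨w ![], ?_⟩
  have h1 : Φ b u = diff x y ![] + dQ b (w ![]) := congrArg (fun t => t ![]) e
  rw [h1, add_sub_cancel_right]
  exact diff_mem_smul x ⊤ y (fun _ => trivial) _

end Chase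

end KoszulCochain

namespace PolyRing

open KoszulCochain

universe u'

lemma one_tmul_eq_zero_iff {S : Type*} [CommRing S] (I : Ideal S) {A : Type*} [AddCommGroup A]
    [Module S A] (v : A) :
    (1 : S ⧸ I) ⊗ₜ[S] v = 0 ↔ v ∈ I • (⊤ : Submodule S A) := by
  rw [← (TensorProduct.quotTensorEquivQuotSMul A I).map_eq_zero_iff]
  have h : TensorProduct.quotTensorEquivQuotSMul A I ((1 : S ⧸ I) ⊗ₜ[S] v) =
      Submodule.Quotient.mk v := by
    simp
  rw [h, Submodule.Quotient.mk_eq_zero]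

lemma exists_one_tmul_eq {S : Type*} [CommRing S] (I : Ideal S) {A : Type*} [AddCommGroup A]
    [Module S A] (v : TensorProduct S (S ⧸ I) A) : ∃ w : A, (1 : S ⧸ I) ⊗ₜ[S] w = v := by
  induction v using TensorProduct.induction_on with
  | zero => exact ⟨0, TensorProduct.tmul_zero _ _⟩
  | tmul r a =>
    obtain ⟨r, rfl⟩ := Ideal.Quotient.mk_surjective r
    refine ⟨r • a, ?_⟩
    rw [← TensorProduct.smul_tmul, Algebra.smul_def, mul_one]
    rfl
  | add v w hv hw =>
    obtain ⟨v, rfl⟩ := hv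
    obtain ⟨w, rfl⟩ := hw
    exact ⟨v + w, TensorProduct.tmul_add _ _ _⟩

lemma homologyMap_eq_zero_of_forall {S : Type u'} [CommRing S]
    {C D : ChainComplex (ModuleCat.{u'} S) ℕ} (f : C ⟶ D) (i : ℕ)
    (h : ∀ v : C.X i, (∀ j, C.d i j v = 0) → ∃ w : D.X (i + 1), D.d (i + 1) i w = f.f i v) :
    HomologicalComplex.homologyMap f i = 0 := by
  rw [← cancel_epi (C.homologyπ i), HomologicalComplex.homologyπ_naturality, Limits.comp_zero]
  ext c
  obtain ⟨w, hw⟩ := h (C.iCycles i c) fun j => by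
    rw [← ModuleCat.comp_apply, C.iCycles_d]; rfl
  have hc : HomologicalComplex.cyclesMap f i c = D.toCycles (i + 1) i w := by
    refine (ModuleCat.mono_iff_injective (D.iCycles i)).1 inferInstance ?_
    rw [← ModuleCat.comp_apply, ← ModuleCat.comp_apply, HomologicalComplex.cyclesMap_i,
      HomologicalComplex.toCycles_i, hw]
    rfl
  rw [ModuleCat.comp_apply, hc, ← ModuleCat.comp_apply, HomologicalComplex.toCycles_comp_homologyπ]
  rfl

end PolyRing

end

/-! ### Identification with `Tor`. -/

section

open CategoryTheory MonoidalCategory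

namespace PolyRing

open MvPolynomial KoszulCochain

lemma isTorVanishing_of_isKoszulVanishing {k : Type u} [Field k] {n : ℕ} {M N : Type u}
    [AddCommGroup M] [AddCommGroup N] [Module (MvPolynomial (Fin n) k) M]
    [Module (MvPolynomial (Fin n) k) N] {φ : M →ₗ[MvPolynomial (Fin n) k] N}
    (hφ : IsKoszulVanishing X φ) : IsTorVanishing φ := by
  intro i
  let P := projectiveResolution (ModuleCat.of (MvPolynomial (Fin n) k) M)
  let Q := projectiveResolution (ModuleCat.of (MvPolynomial (Fin n) k) N)
  let g := ProjectiveResolution.lift (ModuleCat.ofHom φ) P Q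
  have hg : g ≫ Q.π = P.π ≫ (ChainComplex.single₀ _).map (ModuleCat.ofHom φ) :=
    ProjectiveResolution.lift_commutes _ P Q
  let εP : P.complex.X 0 ⟶ ModuleCat.of (MvPolynomial (Fin n) k) M := P.π.f 0
  let εQ : Q.complex.X 0 ⟶ ModuleCat.of (MvPolynomial (Fin n) k) N := Q.π.f 0
  have hεd : P.complex.d 1 0 ≫ εP = 0 := P.complex_d_comp_π_f_zero
  have hQε : Function.Exact (Q.complex.d 1 0).hom εQ.hom :=
    (ShortComplex.ShortExact.moduleCat_exact_iff_function_exact _).1 Q.exact₀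
  have hQ (b : ℕ) : Function.Exact (Q.complex.d (b + 2) (b + 1)).hom (Q.complex.d (b + 1) b).hom :=
    (ShortComplex.ShortExact.moduleCat_exact_iff_function_exact _).1 (Q.exact_succ b)
  have hεQ : Function.Surjective εQ.hom :=
    (ModuleCat.epi_iff_surjective εQ).1 (inferInstanceAs (Epi (Q.π.f 0)))
  have hg0 : g.f 0 ≫ εQ = εP ≫ ModuleCat.ofHom φ := by
    have h := congrArg (fun t => HomologicalComplex.Hom.f t 0) hg
    exact h
  have hproj (b : ℕ) : IsAcyclic (X : Fin n → MvPolynomial (Fin n) k) (P.complex.X b) := by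
    have : Module.Projective (MvPolynomial (Fin n) k) (P.complex.X b) :=
      (IsProjective.iff_projective _).2 (P.projective b)
    exact isAcyclic_of_projective _
  change (((tensoringLeft (ModuleCat.{u} (MvPolynomial (Fin n) k))).obj
    (residueModule k n)).leftDerived i).map (ModuleCat.ofHom φ) = 0
  -- The map on `Tor` is computed by any lift of `φ` to projective resolutions; elements of `k ⊗
  -- P_i` are represented by elements of `P_i` modulo `𝔪`, where the chase applies.
  rw [Functor.leftDerived_map_eq _ i (ModuleCat.ofHom φ) g hg]
  have hzero : (((tensoringLeft (ModuleCat.{u} (MvPolynomial (Fin n) k))).obj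
      (residueModule k n)).mapHomologicalComplex (ComplexShape.down ℕ) ⋙
        HomologicalComplex.homologyFunctor _ _ i).map g = 0 := by
    refine homologyMap_eq_zero_of_forall _ i fun v hv => ?_
    obtain ⟨u, rfl⟩ := exists_one_tmul_eq (A := P.complex.X i) (idealOfVars (Fin n) k) v
    obtain ⟨w, hw⟩ := exists_sub_mem_smul_top X (φ := φ)
      (dP := fun b => (P.complex.d (b + 1) b).hom) (εP := εP.hom)
      (dQ := fun b => (Q.complex.d (b + 1) b).hom) (εQ := εQ.hom) (Φ := fun b => (g.f b).hom)
      hproj (fun b v => by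
        rw [← ModuleCat.comp_apply, P.complex.d_comp_d]; rfl)
      (fun v => by
        have h := congrArg (fun t => t.hom v) hεd
        exact h)
      hεQ hQε hQ
      (fun b v => by
        have h := congrArg (fun t => t.hom v) (g.comm (b + 1) b)
        exact h)
      (fun v => by
        have h := congrArg (fun t => t.hom v) hg0
        exact h)
      hφ i u (by
        rintro c rfl
        exact (one_tmul_eq_zero_iff _ _).1 (hv c))
    refine ⟨(1 : MvPolynomial (Fin n) k ⧸ idealOfVars (Fin n) k) ⊗ₜ w, ?_⟩
    have h := (one_tmul_eq_zero_iff _ _).2 hw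
    rw [TensorProduct.tmul_sub, sub_eq_zero] at h
    exact h.symm
  rw [hzero, Limits.zero_comp, Limits.comp_zero]

end PolyRing

end

theorem mainTheorem6 {k : Type u} [Field k] (n : ℕ) (I : Ideal (MvPolynomial (Fin n) k))
    (hI : PolyRing.IsHomogeneousIdeal I) (hIm : I ≤ MvPolynomial.idealOfVars (Fin n) k ^ 2)
    (s : ℕ) (hs : 1 ≤ s)
    (h : CharZero k ∨ PolyRing.IsMonomialIdeal I ∨
      ∀ t : ℕ, 1 ≤ t → t ≤ s → PolyRing.IsKoszulIdeal (I ^ t)) :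
    ∀ t : ℕ, 1 ≤ t → t ≤ s →
      ∃ hle : MvPolynomial.idealOfVars (Fin n) k ^ (s - t) * I ^ t ≤
          MvPolynomial.idealOfVars (Fin n) k ^ (s - t + 1) * I ^ (t - 1),
        PolyRing.IsTorVanishing (Submodule.inclusion hle) := by
  intro t ht hts
  obtain ⟨t, rfl⟩ := Nat.exists_eq_succ_of_ne_zero (by omega : t ≠ 0)
  rw [Nat.succ_eq_add_one, Nat.add_sub_cancel]
  have hle : MvPolynomial.idealOfVars (Fin n) k ^ (s - (t + 1)) * I ^ (t + 1) ≤
      MvPolynomial.idealOfVars (Fin n) k ^ (s - (t + 1) + 1) * I ^ t :=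
    (PolyRing.pow_mul_pow_succ_le hIm _ t).trans Ideal.mul_le_right
  refine ⟨hle, PolyRing.isTorVanishing_of_isKoszulVanishing ?_⟩
  rcases h with h | h | h
  · exact PolyRing.isKoszulVanishing_of_charZero hI hIm _ t hle
  · exact PolyRing.isKoszulVanishing_of_remainder_mem
      (PolyRing.remainder_mem_of_monomial h) hIm _ t hle
  · exact PolyRing.isKoszulVanishing_of_isKoszulIdeal hIm _ t
      (fun h1 => h t h1 (by omega)) hle
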